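/- Let $Q_1=\chi_{[0,1)}$ and $Q_{m+1}(x)=\int_{-\infty}^{\infty}Q_m(x-s)Q_1(s)\,ds$ $(m\ge 1)$ be the $B$-splines, and for $m\ge 1$, $0\le\beta<1$ and $t\in\mathbb{C}\setminus\{0,1\}$ let $$\Phi_{m-1}(\beta,t)=\sum_{k\in\mathbb{Z}}t^kQ_m(\beta-k)$$ be the exponential spline of degree $m-1$ to the base $t$. For $\beta\in\mathbb{R}$ let $G_m(t,\beta)$, $m\ge1$, be the polynomials in $t$ given by $G_1(t,\beta)=-1$ and, for $m\ge 2$, $$G_m(t,\beta)=[\beta(t-1)-(m-1)t]\,G_{m-1}(t,\beta)+t(t-1)\,G_{m-1}'(t,\beta),$$ where $'$ denotes the derivative with respect to $t$. Then, for every $m\ge1$ and $\beta\in\mathbb{R}$, $G_m$ is the polynomial in $t$ with $G_m(e^{2\pi ix},\beta)=F_m(e^{i\pi x},\beta)$ for all $x\in(0,1)$, where $$F_m(e^{i\pi x},\beta)=e^{m\pi ix}e^{-2\pi i\beta x}\,\frac{\sin^m\pi x}{\pi^{m-1}}\,\frac{d^{m-1}}{dx^{m-1}}\Big((i-\cot\pi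 x)\,e^{2\pi i\beta x}\Big).$$ Moreover, for $0\le\beta<1$ and $t\in\mathbb{C}$, $t\ne0,1$, the series defining $\Phi_{m-1}(\beta,t)$ converges, $\Phi_{m-1}(\beta,t)$ is differentiable in $t$, and the following hold. (i) For all $m\ge1$, $$\Phi_{m-1}(\beta,t)=\frac{(-1)^m}{(m-1)!}\,G_m\Big(\frac1t,\beta\Big).$$ (ii) For all $m\ge2$, with $'$ denoting the derivative with respect to $t$, $$t(m-1)\,\Phi_{m-1}(\beta,t)=\big(m-1+\beta(t-1)\big)\,\Phi_{m-2}(\beta,t)+t(1-t)\,\Phi_{m-2}'(\beta,t).$$ -/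

import Mathlib

open Complex Polynomial MeasureTheory
open scoped Nat

noncomputable section

/-- The cardinal B-spline `Q_m` of order `m ≥ 1`: `Q_1` is the indicator function of `[0, 1)` and
`Q_{m+1}(x) = ∫ Q_m(x - s) Q_1(s) ds`. The index `0` is unused. -/
def bSpline : ℕ → ℝ → ℝ
  | 0 => fun _ => 0
  | 1 => (Set.Ico (0 : ℝ) 1).indicator 1
  | (m + 2) => fun x => ∫ s : ℝ, bSpline (m + 1) (x - s) * (Set.Ico (0 : ℝ) 1).indicator 1 s

/-- The exponential spline `Φ_n(β, t) = ∑_{k ∈ ℤ} t^k Q_{n+1}(β - k)` of degree `n` to the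
base `t`. -/
def expSpline (n : ℕ) (β : ℝ) (t : ℂ) : ℂ :=
  ∑' k : ℤ, t ^ k * (bSpline (n + 1) (β - k) : ℂ)

/-- The value `F_m(e^{iπx}, β)`, for `x ∈ (0, 1)` and `m ≥ 1`, that is,
`e^{mπix} e^{-2πiβx} (sin^m πx / π^{m-1}) (d/dx)^{m-1} ((i - cot πx) e^{2πiβx})`. -/
def cotF (m : ℕ) (β x : ℝ) : ℂ :=
  exp (m * Real.pi * I * x) * exp (-(2 * Real.pi * I * β * x)) *
    ((Real.sin (Real.pi * x) ^ m / Real.pi ^ (m - 1) : ℝ) : ℂ) *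
    iteratedDeriv (m - 1)
      (fun y : ℝ => (I - (Real.cot (Real.pi * y) : ℂ)) * exp (2 * Real.pi * I * β * y)) x

/-- The polynomials `G_m(t, β)` in the variable `t`, for `m ≥ 1`: `G_1 = -1` and
`G_m = [β(t-1) - (m-1)t] G_{m-1} + t(t-1) G_{m-1}'`. The index `0` is unused. -/
def polyG : ℕ → ℝ → ℂ[X]
  | 0, _ => 0
  | 1, _ => -1
  | (m + 2), β =>
      (C (β : ℂ) * (X - 1) - ((m + 1 : ℕ) : ℂ[X]) * X) * polyG (m + 1) β +
        X * (X - 1) * derivative (polyG (m + 1) β)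

end

/-! Everything rests on one identity: for `0 ≤ β < 1` the coefficient of `t^j` in `G_m` is `(-1)^m
(m-1)! Q_m(β + j)` (`coeff_polyG`). Comparing coefficients in the recursion for `G_m` gives exactly
the two-term recurrence of B-splines (`bSpline_recurrence`). Summing over `k = -j` yields (i), and
(ii) is the recursion for `G_m` read at `1/t`. The formula for `F_m` is independent of splines: with
`u = e^{2πix}`, `i - cot πx = -2i/(u - 1)`, and each differentiation in `x` performs one step of the
same recursion. -/

/-! ### B-splines: one-sided regularity and the two-term recurrence -/

/-- Each B-spline is obtained from the previous one by integration over a unit window. -/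
theorem bSpline_succ (m : ℕ) (x : ℝ) :
    bSpline (m + 2) x = ∫ s in (x - 1)..x, bSpline (m + 1) s := by
  have h : bSpline (m + 2) x
      = ∫ s : ℝ, (Set.Ico (0 : ℝ) 1).indicator (fun s => bSpline (m + 1) (x - s)) s := by
    simp only [bSpline]
    congr 1
    ext s
    by_cases hs : s ∈ Set.Ico (0 : ℝ) 1 <;> simp [Set.indicator, hs]
  rw [h, integral_indicator measurableSet_Ico, integral_Ico_eq_integral_Ioo,
    ← integral_Ioc_eq_integral_Ioo, ← intervalIntegral.integral_of_le zero_le_one,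
    intervalIntegral.integral_comp_sub_left (fun s => bSpline (m + 1) s) x, sub_zero]

theorem bSpline_of_neg (m : ℕ) {x : ℝ} (hx : x < 0) : bSpline (m + 1) x = 0 := by
  induction m generalizing x with
  | zero => simp [bSpline, hx.not_ge]
  | succ m ih =>
    rw [bSpline_succ, intervalIntegral.integral_congr (g := fun _ => (0 : ℝ)),
      intervalIntegral.integral_zero]
    intro s hs
    rw [Set.uIcc_of_le (by linarith)] at hs
    exact ih (by linarith [hs.2])

theorem continuous_bSpline_succ_of_intervalIntegrable (m : ℕ)
    (h : ∀ a b : ℝ, IntervalIntegrable (bSpline (m + 1)) volume a b) :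
    Continuous (bSpline (m + 2)) := by
  have hP : Continuous fun x : ℝ => ∫ s in (0 : ℝ)..x, bSpline (m + 1) s :=
    intervalIntegral.continuous_primitive h 0
  have hEq : bSpline (m + 2) = fun x : ℝ => (∫ s in (0 : ℝ)..x, bSpline (m + 1) s)
      - ∫ s in (0 : ℝ)..(x - 1), bSpline (m + 1) s := by
    ext x
    rw [bSpline_succ, intervalIntegral.integral_interval_sub_left (h _ _) (h _ _)]
  rw [hEq]
  exact hP.sub (hP.comp (continuous_id.sub continuous_const))

theorem intervalIntegrable_bSpline (m : ℕ) (a b : ℝ) :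
    IntervalIntegrable (bSpline (m + 1)) volume a b := by
  induction m generalizing a b with
  | zero =>
    refine Integrable.intervalIntegrable ?_
    simp only [bSpline]
    exact (integrable_indicator_iff measurableSet_Ico).2
      (integrableOn_const (by simp) (by simp))
  | succ m ih => exact (continuous_bSpline_succ_of_intervalIntegrable m ih).intervalIntegrable a b

theorem continuous_bSpline (m : ℕ) : Continuous (bSpline (m + 2)) :=
  continuous_bSpline_succ_of_intervalIntegrable m (intervalIntegrable_bSpline m)

/-- `Q_1` jumps at `0` and `1`, but `[0, 1)` is closed on the left, so right limits agree with
values. Right derivatives thus exist at every point and no breakpoint needs separate care. -/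
theorem continuousWithinAt_bSpline (m : ℕ) (x : ℝ) :
    ContinuousWithinAt (bSpline (m + 1)) (Set.Ici x) x := by
  cases m with
  | succ m => exact (continuous_bSpline m).continuousWithinAt
  | zero =>
    simp only [bSpline]
    have key : ∃ y, x < y ∧ ∀ z ∈ Set.Ico x y,
        (Set.Ico (0 : ℝ) 1).indicator (1 : ℝ → ℝ) z = (Set.Ico (0 : ℝ) 1).indicator 1 x := by
      rcases lt_or_ge x 0 with h | h
      · refine ⟨0, h, fun z hz => ?_⟩
        rw [Set.indicator_of_notMem fun h' => hz.2.not_ge h'.1,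
          Set.indicator_of_notMem fun h' => h.not_ge h'.1]
      rcases lt_or_ge x 1 with h1 | h1
      · refine ⟨1, h1, fun z hz => ?_⟩
        rw [Set.indicator_of_mem (show z ∈ Set.Ico (0 : ℝ) 1 from ⟨h.trans hz.1, hz.2⟩),
          Set.indicator_of_mem (show x ∈ Set.Ico (0 : ℝ) 1 from ⟨h, h1⟩)]
        rfl
      · refine ⟨x + 1, by linarith, fun z hz => ?_⟩
        rw [Set.indicator_of_notMem fun h' => (h1.trans hz.1).not_gt h'.2,
          Set.indicator_of_notMem fun h' => h1.not_gt h'.2]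
    obtain ⟨y, hxy, hy⟩ := key
    refine ContinuousWithinAt.congr_of_eventuallyEq
      (f := fun _ => (Set.Ico (0 : ℝ) 1).indicator (1 : ℝ → ℝ) x) continuousWithinAt_const ?_ rfl
    filter_upwards [Ico_mem_nhdsGE hxy] with z hz using hy z hz

theorem hasDerivWithinAt_bSpline_primitive (m : ℕ) (x : ℝ) :
    HasDerivWithinAt (fun y : ℝ => ∫ s in (0 : ℝ)..y, bSpline (m + 1) s)
      (bSpline (m + 1) x) (Set.Ici x) x := by
  refine intervalIntegral.integral_hasDerivWithinAt_right (intervalIntegrable_bSpline m _ _)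
    (t := Set.Ioi x) ?_ ((continuousWithinAt_bSpline m x).mono Set.Ioi_subset_Ici_self)
  have h : LocallyIntegrable (bSpline (m + 1)) volume := by
    intro y
    refine ⟨Set.Ioc (y - 1) (y + 1), Ioc_mem_nhds (by linarith) (by linarith), ?_⟩
    exact (intervalIntegrable_iff_integrableOn_Ioc_of_le (by linarith)).1
      (intervalIntegrable_bSpline m (y - 1) (y + 1))
  exact ⟨Set.univ, Filter.univ_mem, h.aestronglyMeasurable.restrict⟩

/-- The right derivative of a B-spline is a backward difference of the previous one. -/
theorem hasDerivWithinAt_bSpline (m : ℕ) (x : ℝ) :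
    HasDerivWithinAt (bSpline (m + 2)) (bSpline (m + 1) x - bSpline (m + 1) (x - 1))
      (Set.Ici x) x := by
  have hEq : bSpline (m + 2) = fun x : ℝ => (∫ s in (0 : ℝ)..x, bSpline (m + 1) s)
      - ∫ s in (0 : ℝ)..(x - 1), bSpline (m + 1) s := by
    ext x
    rw [bSpline_succ, intervalIntegral.integral_interval_sub_left
      (intervalIntegrable_bSpline m _ _) (intervalIntegrable_bSpline m _ _)]
  rw [hEq]
  refine (hasDerivWithinAt_bSpline_primitive m x).sub ?_
  have h := (hasDerivWithinAt_bSpline_primitive m (x - 1)).scomp x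
    (((hasDerivAt_id x).sub_const 1).hasDerivWithinAt (s := Set.Ici x))
    (fun y (hy : x ≤ y) => by simpa using hy)
  simpa [Function.comp_def] using h

theorem bSpline_two (x : ℝ) :
    bSpline 2 x = x * bSpline 1 x + (2 - x) * bSpline 1 (x - 1) := by
  -- `Q_2(x)` is the length of the overlap of the window `(x - 1, x]` with `[0, 1)`.
  have h : bSpline 2 x = volume.real (Set.Ioc (x - 1) x ∩ Set.Ico 0 1) := by
    rw [bSpline_succ 0, intervalIntegral.integral_of_le (by linarith)]
    simp only [bSpline]
    rw [integral_indicator_one measurableSet_Ico, measureReal_restrict_apply measurableSet_Ico,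
      Set.inter_comm]
  rw [h]
  simp only [bSpline, Set.indicator, Set.mem_Ico, Pi.one_apply]
  rcases lt_or_ge x 0 with h0 | h0
  · rw [show Set.Ioc (x - 1) x ∩ Set.Ico 0 1 = ∅ by ext s; simp; intros; linarith]
    simp [h0.not_ge, show ¬ (1 ≤ x) by linarith]
  rcases lt_or_ge x 1 with h1 | h1
  · rw [show Set.Ioc (x - 1) x ∩ Set.Ico 0 1 = Set.Icc 0 x by ext s; simp; grind]
    simp [h0, h1, h1.not_ge]
  rcases lt_or_ge x 2 with h2 | h2
  · rw [show Set.Ioc (x - 1) x ∩ Set.Ico 0 1 = Set.Ioo (x - 1) 1 by ext s; simp; grind]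
    rw [Real.volume_real_Ioo_of_le (by linarith)]
    simp [h1, h1.not_gt, show x - 1 < 1 by linarith]
    ring
  · rw [show Set.Ioc (x - 1) x ∩ Set.Ico 0 1 = ∅ by ext s; simp; grind]
    simp [h1.not_gt, show ¬ (x - 1 < 1) by linarith]

/-- The two-term recurrence for cardinal B-splines. -/
theorem bSpline_recurrence (m : ℕ) (x : ℝ) :
    ((m : ℝ) + 1) * bSpline (m + 2) x
      = x * bSpline (m + 1) x + ((m : ℝ) + 2 - x) * bSpline (m + 1) (x - 1) := by
  induction m generalizing x with
  | zero => simpa using bSpline_two x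
  | succ m ih =>
    -- The defect of the recurrence: continuous, zero on the negative axis, and with vanishing right
    -- derivative, hence zero.
    set R : ℝ → ℝ := fun x => x * bSpline (m + 2) x + ((m : ℝ) + 3 - x) * bSpline (m + 2) (x - 1)
      - ((m : ℝ) + 2) * bSpline (m + 3) x with hR
    have hc : Continuous R := by
      have h1 := continuous_bSpline m
      have h2 := continuous_bSpline (m + 1)
      fun_prop
    have hd : ∀ y, HasDerivWithinAt R 0 (Set.Ici y) y := by
      intro y
      have hid := hasDerivWithinAt_id y (Set.Ici y)
      have h1 := hasDerivWithinAt_bSpline m y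
      have h2 := hasDerivWithinAt_bSpline (m + 1) y
      have h3 := (hasDerivWithinAt_bSpline m (y - 1)).scomp y
        (((hasDerivAt_id y).sub_const 1).hasDerivWithinAt (s := Set.Ici y))
        (fun z (hz : y ≤ z) => by simpa using hz)
      have h := ((hid.mul h1).add ((hid.const_sub ((m : ℝ) + 3)).mul h3)).sub
        (h2.const_mul ((m : ℝ) + 2))
      refine h.congr_deriv ?_
      have e1 := ih y
      have e2 := ih (y - 1)
      simp only [id, Function.comp_apply, smul_eq_mul]
      -- The right derivative of `R` is the defect of the previous recurrence at `y` minus that at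
      -- `y - 1`.
      linear_combination e2 - e1
    have hz : R x = 0 := by
      have ha : min x (-1) < 0 := (min_le_right _ _).trans_lt (by norm_num)
      rw [constant_of_has_deriv_right_zero (a := min x (-1)) (b := x) hc.continuousOn
        (fun y _ => hd y) x ⟨min_le_left _ _, le_rfl⟩]
      simp only [hR]
      rw [bSpline_of_neg (m + 1) ha, bSpline_of_neg (m + 1) (x := _ - 1) (by linarith),
        bSpline_of_neg (m + 2) ha]
      ring
    push_cast
    simp only [hR] at hz
    linear_combination -hz

/-! ### Coefficients of `G_m` -/

theorem polyG_succ (m : ℕ) (β : ℝ) :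
    polyG (m + 2) β = (C (β : ℂ) * (X - 1) - ((m + 1 : ℕ) : ℂ[X]) * X) * polyG (m + 1) β +
      X * (X - 1) * derivative (polyG (m + 1) β) := rfl

theorem coeff_zero_polyG_succ (m : ℕ) (β : ℝ) :
    (polyG (m + 2) β).coeff 0 = -β * (polyG (m + 1) β).coeff 0 := by
  simp [polyG_succ, mul_coeff_zero]

theorem coeff_succ_polyG_succ (m j : ℕ) (β : ℝ) :
    (polyG (m + 2) β).coeff (j + 1) = -(β + (j + 1)) * (polyG (m + 1) β).coeff (j + 1)
      - (m + 2 - (β + (j + 1))) * (polyG (m + 1) β).coeff j := by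
  set p := polyG (m + 1) β with hp
  have h : polyG (m + 2) β = X * (C (β - (m + 1) : ℂ) * p + X * derivative p - derivative p)
      - C (β : ℂ) * p := by
    rw [polyG_succ]
    simp only [map_sub, map_add, map_natCast, map_one]
    push_cast
    ring
  rw [h, coeff_sub, coeff_X_mul, coeff_sub, coeff_add, coeff_C_mul, coeff_C_mul,
    coeff_derivative]
  cases j with
  | zero => simp; ring
  | succ j => rw [coeff_X_mul, coeff_derivative]; push_cast; ring

/-- The coefficients of `G_m` are, up to normalisation, values of B-splines. -/
theorem coeff_polyG (m j : ℕ) {β : ℝ} (h0 : 0 ≤ β) (h1 : β < 1) :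
    (polyG (m + 1) β).coeff j = (-1) ^ (m + 1) * (m ! : ℂ) * (bSpline (m + 1) (β + j) : ℂ) := by
  induction m generalizing j with
  | zero =>
    cases j with
    | zero => simp [polyG, bSpline, h0, h1]
    | succ j =>
      have : ¬ (β + (j + 1 : ℝ) < 1) := by have : (0 : ℝ) ≤ j := j.cast_nonneg; linarith
      simp [polyG, bSpline, this, coeff_one]
  | succ m ih =>
    have hrec := congrArg (fun y : ℝ => (y : ℂ)) (bSpline_recurrence m (β + j))
    push_cast at hrec
    rw [Nat.factorial_succ]
    push_cast
    cases j with
    | zero =>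
      rw [coeff_zero_polyG_succ, ih]
      -- Since `β - 1 < 0`, the second term of the recurrence drops out, just as the constant
      -- coefficient has no lower neighbour.
      have hz : bSpline (m + 1) (β + (0 : ℕ) - 1) = 0 :=
        bSpline_of_neg m (by push_cast; linarith)
      rw [hz] at hrec
      push_cast at hrec ⊢
      linear_combination (-(-1) ^ (m + 2) * (m ! : ℂ)) * hrec
    | succ j =>
      rw [coeff_succ_polyG_succ, ih, ih]
      rw [show β + ((j + 1 : ℕ) : ℝ) - 1 = β + j by push_cast; ring] at hrec
      push_cast at hrec ⊢
      linear_combination (-(-1) ^ (m + 2) * (m ! : ℂ)) * hrec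

/-! ### Exponential splines -/

theorem hasSum_expSpline (m : ℕ) {β : ℝ} (h0 : 0 ≤ β) (h1 : β < 1) (t : ℂ) :
    HasSum (fun k : ℤ => t ^ k * (bSpline (m + 1) (β - k) : ℂ))
      ((-1) ^ (m + 1) / (m ! : ℂ) * (polyG (m + 1) β).eval (1 / t)) := by
  have hinj : Function.Injective fun j : ℕ => -(j : ℤ) := fun a b h => by simpa using h
  refine (hinj.hasSum_iff fun k hk => ?_).1 ?_
  -- For `k > 0` the argument `β - k` is negative, so only `k = -j` with `j ≥ 0` contributes.
  · have hk' : 0 < k := by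
      by_contra h
      exact hk ⟨k.natAbs, by simp only; omega⟩
    have : (1 : ℝ) ≤ k := by exact_mod_cast hk'
    rw [bSpline_of_neg m (by linarith)]
    simp
  · have hm : (m ! : ℂ) ≠ 0 := by exact_mod_cast m.factorial_ne_zero
    have hs : ((-1) ^ (m + 1) : ℂ) * (-1) ^ (m + 1) = 1 := by rw [← mul_pow]; simp
    have hterm : ((fun k : ℤ => t ^ k * (bSpline (m + 1) (β - k) : ℂ)) ∘ fun j : ℕ => -(j : ℤ))
        = fun j : ℕ => (-1) ^ (m + 1) / (m ! : ℂ) *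
          ((polyG (m + 1) β).coeff j * (1 / t) ^ j) := by
      ext j
      rw [coeff_polyG m j h0 h1]
      simp only [Function.comp_apply, Int.cast_neg, Int.cast_natCast, sub_neg_eq_add, zpow_neg,
        zpow_natCast, one_div, inv_pow]
      field_simp
      linear_combination (-(bSpline (m + 1) (β + j) : ℂ) * (t ^ j)⁻¹) * hs
    rw [hterm, eval_eq_sum_range]
    refine HasSum.mul_left _ (hasSum_sum_of_ne_finset_zero fun j hj => ?_)
    rw [coeff_eq_zero_of_natDegree_lt (by simpa using hj), zero_mul]

theorem expSpline_eq (m : ℕ) {β : ℝ} (h0 : 0 ≤ β) (h1 : β < 1) (t : ℂ) :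
    expSpline m β t = (-1) ^ (m + 1) / (m ! : ℂ) * (polyG (m + 1) β).eval (1 / t) :=
  (hasSum_expSpline m h0 h1 t).tsum_eq

theorem hasDerivAt_expSpline (m : ℕ) {β : ℝ} (h0 : 0 ≤ β) (h1 : β < 1) {t : ℂ} (ht : t ≠ 0) :
    HasDerivAt (expSpline m β) ((-1) ^ (m + 1) / (m ! : ℂ) *
      ((derivative (polyG (m + 1) β)).eval (1 / t) * (-(t ^ 2)⁻¹))) t := by
  -- This holds at `t = 0` as well, by the convention `0⁻¹ = 0`, so it is an equality of functions.
  have hEq : expSpline m β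
      = fun t => (-1) ^ (m + 1) / (m ! : ℂ) * (polyG (m + 1) β).eval (t⁻¹) :=
    funext fun s => by rw [expSpline_eq m h0 h1 s, one_div]
  rw [hEq, one_div]
  exact (((polyG (m + 1) β).hasDerivAt t⁻¹).comp t (hasDerivAt_inv ht)).const_mul _

theorem expSpline_recurrence (m : ℕ) {β : ℝ} (h0 : 0 ≤ β) (h1 : β < 1) {t : ℂ} (ht : t ≠ 0) :
    t * ((m : ℂ) + 1) * expSpline (m + 1) β t
      = ((m : ℂ) + 1 + (β : ℂ) * (t - 1)) * expSpline m β t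
        + t * (1 - t) * deriv (expSpline m β) t := by
  have hm : (m ! : ℂ) ≠ 0 := by exact_mod_cast m.factorial_ne_zero
  have hm1 : (m : ℂ) + 1 ≠ 0 := by exact_mod_cast m.succ_ne_zero
  rw [(hasDerivAt_expSpline m h0 h1 ht).deriv, expSpline_eq m h0 h1, expSpline_eq (m + 1) h0 h1,
    polyG_succ, Nat.factorial_succ]
  simp only [eval_add, eval_sub, eval_mul, eval_C, eval_X, eval_one, eval_natCast]
  push_cast
  field_simp
  ring

/-! ### The cotangent formula -/

theorem exp_sq_sub_one (x : ℝ) :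
    exp (2 * Real.pi * I * x) - 1
      = 2 * I * (Real.sin (Real.pi * x) : ℂ) * exp (Real.pi * I * x) := by
  have h2 : exp (2 * Real.pi * I * x) = exp (Real.pi * I * x) ^ 2 := by
    rw [← Complex.exp_nat_mul]; congr 1; push_cast; ring
  have hn : exp (-(Real.pi * x : ℂ) * I) * exp (Real.pi * I * x) = 1 := by
    rw [← Complex.exp_add]; ring_nf; simp
  have hp : exp ((Real.pi * x : ℂ) * I) = exp (Real.pi * I * x) := by congr 1; ring
  rw [h2]
  push_cast
  rw [Complex.sin, hp]
  linear_combination (exp (Real.pi * I * x) ^ 2 - 1) * I_sq - I ^ 2 * hn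

theorem I_sub_cot_eq {x : ℝ} (hx : Real.sin (Real.pi * x) ≠ 0) :
    I - (Real.cot (Real.pi * x) : ℂ) = -(2 * I) / (exp (2 * Real.pi * I * x) - 1) := by
  have hs : (Real.sin (Real.pi * x) : ℂ) ≠ 0 := by exact_mod_cast hx
  have hn : exp (-(Real.pi * x : ℂ) * I) * exp (Real.pi * I * x) = 1 := by
    rw [← Complex.exp_add]; ring_nf; simp
  have hE : exp (-(Real.pi * x : ℂ) * I) = Real.cos (Real.pi * x) - Real.sin (Real.pi * x) * I := by
    rw [Complex.exp_mul_I, Complex.cos_neg, Complex.sin_neg]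
    push_cast
    ring
  rw [hE] at hn
  rw [exp_sq_sub_one, Real.cot_eq_cos_div_sin, ofReal_div]
  have := I_ne_zero
  have hu := Complex.exp_ne_zero (Real.pi * I * x)
  generalize exp (Real.pi * I * x) = u at hn hu ⊢
  field_simp
  linear_combination -hn

/-- The iterated derivatives of `(i - cot πx) e^{2πiβx}` in terms of the polynomials `G_m`. -/
theorem iteratedDeriv_cot_mul_exp (n : ℕ) (β : ℝ) {x : ℝ} (hx : x ∈ Set.Ioo (0 : ℝ) 1) :
    iteratedDeriv n
      (fun y : ℝ => (I - (Real.cot (Real.pi * y) : ℂ)) * exp (2 * Real.pi * I * β * y)) x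
      = (Real.pi : ℂ) ^ n * (2 * I) ^ (n + 1) * (exp (2 * Real.pi * I * β * x) *
          (polyG (n + 1) β).eval (exp (2 * Real.pi * I * x)) /
            (exp (2 * Real.pi * I * x) - 1) ^ (n + 1)) := by
  have hsin : ∀ {y : ℝ}, y ∈ Set.Ioo (0 : ℝ) 1 → Real.sin (Real.pi * y) ≠ 0 := fun {y} hy =>
    (Real.sin_pos_of_pos_of_lt_pi (mul_pos Real.pi_pos hy.1)
      (by nlinarith [Real.pi_pos, hy.2])).ne'
  induction n generalizing x with
  | zero =>
    rw [iteratedDeriv_zero, I_sub_cot_eq (hsin hx)]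
    simp [polyG]
    ring
  | succ n ih =>
    rw [iteratedDeriv_succ]
    rw [Filter.EventuallyEq.deriv_eq
      (Filter.eventually_of_mem (isOpen_Ioo.mem_nhds hx) fun y hy => ih hy)]
    have hne : exp (2 * Real.pi * I * x) - 1 ≠ 0 := by
      rw [exp_sq_sub_one]
      have : (Real.sin (Real.pi * x) : ℂ) ≠ 0 := by exact_mod_cast hsin hx
      simp only [ne_eq, mul_eq_zero, OfNat.ofNat_ne_zero, I_ne_zero, this, Complex.exp_ne_zero,
        or_self, not_false_eq_true]
    have hexp : ∀ c : ℂ, HasDerivAt (fun y : ℝ => exp (c * y)) (exp (c * x) * c) x := fun c => by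
      simpa using (((hasDerivAt_id (x : ℂ)).const_mul c).cexp).comp_ofReal
    have hu := hexp (2 * Real.pi * I)
    have hp : HasDerivAt (fun y : ℝ => (polyG (n + 1) β).eval (exp (2 * Real.pi * I * y)))
        ((derivative (polyG (n + 1) β)).eval (exp (2 * Real.pi * I * x)) *
          (exp (2 * Real.pi * I * x) * (2 * Real.pi * I))) x :=
      ((polyG (n + 1) β).hasDerivAt _).comp x hu
    have hd := ((((hexp (2 * Real.pi * I * β)).mul hp).div ((hu.sub_const 1).pow (n + 1))
      (pow_ne_zero _ hne)).const_mul ((Real.pi : ℂ) ^ n * (2 * I) ^ (n + 1))).deriv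
    -- With `p = G_{n+1}`, the quotient rule gives the numerator `(u - 1)(β p + u p') - (n + 1) u
    -- p`, which is `G_{n+2}(u)`.
    refine Eq.trans hd ?_
    rw [polyG_succ]
    simp only [eval_add, eval_sub, eval_mul, eval_C, eval_X, eval_one, eval_natCast, Pi.pow_apply,
      Pi.mul_apply, Nat.add_sub_cancel]
    push_cast
    generalize exp (2 * Real.pi * I * x) = u at hne ⊢
    field_simp
    ring

/-- By `exp_sq_sub_one`, `(u - 1)^(n+1)` is `(2i)^(n+1)` times the sine and exponential powers in
`F_{n+1}`, so every factor except `G_{n+1}(u)` cancels. -/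
theorem eval_polyG_eq_cotF (n : ℕ) (β : ℝ) {x : ℝ} (hx : x ∈ Set.Ioo (0 : ℝ) 1) :
    (polyG (n + 1) β).eval (exp (Real.pi * I * x) ^ 2) = cotF (n + 1) β x := by
  have hs : (Real.sin (Real.pi * x) : ℂ) ≠ 0 := by
    exact_mod_cast (Real.sin_pos_of_pos_of_lt_pi (mul_pos Real.pi_pos hx.1)
      (by nlinarith [Real.pi_pos, hx.2])).ne'
  have hpi : (Real.pi : ℂ) ≠ 0 := by exact_mod_cast Real.pi_ne_zero
  have h2 : exp (Real.pi * I * x) ^ 2 = exp (2 * Real.pi * I * x) := by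
    rw [← Complex.exp_nat_mul]; congr 1; push_cast; ring
  have hm : exp (((n + 1 : ℕ) : ℂ) * Real.pi * I * x) = exp (Real.pi * I * x) ^ (n + 1) := by
    rw [← Complex.exp_nat_mul]; congr 1; ring
  have := I_ne_zero
  have := Complex.exp_ne_zero (Real.pi * I * x)
  have := Complex.exp_ne_zero (2 * Real.pi * I * β * x)
  rw [cotF, Nat.add_sub_cancel, iteratedDeriv_cot_mul_exp n β hx, exp_sq_sub_one, hm,
    Complex.exp_neg, h2]
  push_cast at hs ⊢
  simp only [mul_pow]
  field_simp

theorem mainTheorem6 (m : ℕ) (hm : 1 ≤ m) (β : ℝ) :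
    -- `G_m(u², β) = F_m(u, β)` for `u = e^{iπx}`
    (∀ x ∈ Set.Ioo (0 : ℝ) 1,
      (polyG m β).eval (exp (Real.pi * I * x) ^ 2) = cotF m β x) ∧
    -- (i)
    (0 ≤ β → β < 1 → ∀ t : ℂ, t ≠ 0 → t ≠ 1 →
      Summable (fun k : ℤ => t ^ k * (bSpline m (β - k) : ℂ)) ∧
      expSpline (m - 1) β t
        = (-1) ^ m / ((m - 1)! : ℂ) * (polyG m β).eval (1 / t)) ∧
    -- (ii)
    (2 ≤ m → 0 ≤ β → β < 1 → ∀ t : ℂ, t ≠ 0 → t ≠ 1 →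
      DifferentiableAt ℂ (expSpline (m - 2) β) t ∧
      t * ((m : ℂ) - 1) * expSpline (m - 1) β t
        = ((m : ℂ) - 1 + (β : ℂ) * (t - 1)) * expSpline (m - 2) β t
          + t * (1 - t) * deriv (expSpline (m - 2) β) t) := by
  obtain ⟨n, rfl⟩ : ∃ n, m = n + 1 := ⟨m - 1, by omega⟩
  refine ⟨fun x hx => eval_polyG_eq_cotF n β hx, fun h0 h1 t _ _ => ?_, fun h2 h0 h1 t ht _ => ?_⟩
  · rw [Nat.add_sub_cancel]
    exact ⟨(hasSum_expSpline n h0 h1 t).summable, expSpline_eq n h0 h1 t⟩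
  · obtain ⟨k, rfl⟩ : ∃ k, n = k + 1 := ⟨n - 1, by omega⟩
    rw [show k + 1 + 1 - 2 = k by omega, Nat.add_sub_cancel]
    refine ⟨(hasDerivAt_expSpline k h0 h1 ht).differentiableAt, ?_⟩
    have h := expSpline_recurrence k h0 h1 ht
    push_cast
    linear_combination h
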